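/- Write $|\mathbf 0\rangle=|00\rangle$, $|\mathbf 1\rangle=|01\rangle$, $|\mathbf 2\rangle=|10\rangle$, $|\mathbf 3\rangle=|11\rangle$ for the product basis of a pair of qubits, so $\mathbb C^4=\mathbb C^2\otimes\mathbb C^2$, and let Alice and Bob each hold such a pair. Put $P_{ij}=|\mathbf i\rangle\langle\mathbf i|+|\mathbf j\rangle\langle\mathbf j|$ for $i\ne j$. Consider the following (unnormalized) states in $\mathbb C^4\otimes\mathbb C^4$: \begin{align*} \psi_1&=|\mathbf{00}\rangle+|\mathbf{02}\rangle+|\mathbf{31}\rangle-|\mathbf{33}\rangle, & \psi_4&=|\mathbf{10}\rangle+|\mathbf{12}\rangle+|\mathbf{21}\rangle-|\mathbf{23}\rangle,\\ \psi_2&=|\mathbf{00}\rangle-|\mathbf{02}\rangle-|\mathbf{31}\rangle-|\mathbf{33}\rangle, & \psi_5&=|\mathbf{10}\rangle-|\mathbf{12}\rangle-|\mathbf{21}\rangle-|\mathbf{23}\rangle,\\ \psi_3&=|\mathbf{01}\rangle-|\mathbf{32}\rangle-|\mathbf{30}\rangle-|\mathbf{03}\rangle, & \psi_6&=|\mathbf{11}\rangle-|\mathbf{22}\rangle-|\mathbf{20}\rangle-|\mathbf{13}\rangle,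 \end{align*} and the states in $\mathbb C^2\otimes\mathbb C^4$ $$\varphi_1=|0\mathbf 0\rangle+|0\mathbf 2\rangle+|1\mathbf 1\rangle-|1\mathbf 3\rangle,\quad \varphi_2=|0\mathbf 0\rangle-|0\mathbf 2\rangle-|1\mathbf 1\rangle-|1\mathbf 3\rangle,\quad \varphi_3=|0\mathbf 1\rangle-|1\mathbf 2\rangle-|1\mathbf 0\rangle-|0\mathbf 3\rangle .$$ A family of states is called locally distinguishable if some finite-round two-party LOCC protocol (the parties alternately perform arbitrary finite-outcome local measurements and announce the outcomes) identifies each of its members with probability one. A set of states of the four qubits has local redundancy if, for some nonempty subset of the four qubits, the reduced states after discarding that subset are mutually orthogonal. Then: 1. The states $\psi_1,\dots,\psi_6$ are nonzero and mutually orthogonal, and they have no local redundancy. 2. They are locally distinguishable, by a protocol that begins with Alice's measurement $\{P_{03},P_{12}\}$. The outcome $P_{03}$ leaves $\psi_1,\psi_2,\psi_3$ unchanged and annihilates $\psi_4,\psi_5,\psi_6$; the outcome $P_{12}$ does the reverse. The states $\varphi_1,\varphi_2,\varphi_3$ are locally distinguishable, and each of the triples $(\psi_1,\psi_2,\psi_3)$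 and $(\psi_4,\psi_5,\psi_6)$ is the image of $(\varphi_1,\varphi_2,\varphi_3)$ under a local isometry $V\otimes I$, where $V:\mathbb C^2\to\mathbb C^4$ has range $\operatorname{ran}P_{03}$ for the first triple and $\operatorname{ran}P_{12}$ for the second. 3. Let Bob perform the measurement $\{P_{01},P_{23}\}$. For either outcome the six post-measurement states are nonzero and mutually orthogonal, and they are, up to phases and in order, $$|\mathbf{00}\rangle\pm|\mathbf{31}\rangle,\ |\mathbf{01}\rangle-|\mathbf{30}\rangle,\ |\mathbf{10}\rangle\pm|\mathbf{21}\rangle,\ |\mathbf{11}\rangle-|\mathbf{20}\rangle\quad\text{for } P_{01},$$ $$|\mathbf{02}\rangle\mp|\mathbf{33}\rangle,\ |\mathbf{32}\rangle+|\mathbf{03}\rangle,\ |\mathbf{12}\rangle\mp|\mathbf{23}\rangle,\ |\mathbf{22}\rangle+|\mathbf{13}\rangle\quad\text{for } P_{23}.$$ For either outcome $Q\in\{P_{01},P_{23}\}$, the triple formed by the first three of these states lies in the two-qubit subspace $\operatorname{ran}P_{03}\otimes\operatorname{ran}Q$, and the triple formed by the last three lies in $\operatorname{ran}P_{12}\otimes\operatorname{ran}Q$.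 Each of the two triples is locally indistinguishable, both in $\mathbb C^4\otimes\mathbb C^4$ and as a triple of states in $\mathbb C^2\otimes\mathbb C^2$ after identifying its two-qubit subspace with $\mathbb C^2\otimes\mathbb C^2$ by some local isometries. Consequently, for either outcome the whole set of six converted states is locally indistinguishable. -/

import Mathlib

open scoped Matrix Kronecker

noncomputable section

namespace LocalActivation

/-- Vectors of `ℂ^m ⊗ ℂ^n` (first factor Alice, second factor Bob), with the standard inner
product, written in the product basis. A nonzero vector represents a pure state, not necessarily
normalized. -/
abbrev State (m n : ℕ) : Type := EuclideanSpace ℂ (Fin m × Fin n)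

/-- The product basis vector `|i⟩ ⊗ |j⟩`. -/
def ket {m n : ℕ} (i : Fin m) (j : Fin n) : State m n := EuclideanSpace.single (i, j) 1

/-- The action of the local operator `K ⊗ L`. -/
def localOp {m n m' n' : ℕ} (K : Matrix (Fin m') (Fin m) ℂ) (L : Matrix (Fin n') (Fin n) ℂ)
    (ψ : State m n) : State m' n' :=
  WithLp.toLp 2 ((K ⊗ₖ L) *ᵥ ψ.ofLp)

/-- A general quantum measurement with finitely many outcomes on a `d`-dimensional system:
a complete family of Kraus operators. The output system may have any finite dimension, and this
dimension may depend on the outcome. -/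
structure LocalMeasurement (d : ℕ) where
  outcomes : ℕ
  dim : Fin outcomes → ℕ
  op : (k : Fin outcomes) → Matrix (Fin (dim k)) (Fin d) ℂ
  complete : ∑ k, (op k)ᴴ * op k = 1

/-- Two-party LOCC discrimination protocols on `ℂ^m ⊗ ℂ^n`, with an arbitrary finite number of
rounds, whose final answer is an element of `ι`. Either the protocol stops with an answer, or one
of the parties performs a local measurement and announces the outcome, on which the whole
remaining protocol may depend. (Several outcomes may be followed by the same protocol, so
coarse-grained local operations and shared randomness are included.) -/
inductive LOCC (ι : Type) : ℕ → ℕ → Type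
  | answer {m n : ℕ} (i : ι) : LOCC ι m n
  | alice {m n : ℕ} (M : LocalMeasurement m)
      (next : (k : Fin M.outcomes) → LOCC ι (M.dim k) n) : LOCC ι m n
  | bob {m n : ℕ} (M : LocalMeasurement n)
      (next : (k : Fin M.outcomes) → LOCC ι m (M.dim k)) : LOCC ι m n

/-- `P.weight ψ j` is `‖ψ‖ ^ 2` times the probability that the protocol `P`, run on the
state represented by `ψ`, ends with the answer `j`. -/
def LOCC.weight {ι : Type} [DecidableEq ι] : {m n : ℕ} → LOCC ι m n → State m n → ι → ℝ
  | _, _, .answer i, ψ, j => if i = j then ‖ψ‖ ^ 2 else 0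
  | _, _, .alice M next, ψ, j => ∑ k, (next k).weight (localOp (M.op k) 1 ψ) j
  | _, _, .bob M next, ψ, j => ∑ k, (next k).weight (localOp 1 (M.op k) ψ) j

/-- The protocol identifies each of the states `ψ i` with probability one. -/
def LOCC.Distinguishes {ι : Type} [DecidableEq ι] {m n : ℕ} (P : LOCC ι m n)
    (ψ : ι → State m n) : Prop :=
  ∀ i, P.weight (ψ i) i = ‖ψ i‖ ^ 2

/-- Perfect distinguishability by LOCC. -/
def LocallyDistinguishable {ι : Type} [DecidableEq ι] {m n : ℕ} (ψ : ι → State m n) : Prop :=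
  ∃ P : LOCC ι m n, P.Distinguishes ψ

/-- The states are pairwise orthogonal. -/
def Orthogonal {ι : Type} {m n : ℕ} (ψ : ι → State m n) : Prop :=
  Pairwise fun i j => inner ℂ (ψ i) (ψ j) = 0

/-- The amplitude of a state of `ℂ^4 ⊗ ℂ^4` at a string of four bits. Alice holds the qubits
`0, 1` and Bob the qubits `2, 3`; for each party `|00⟩ = |𝟎⟩`, `|01⟩ = |𝟏⟩`, `|10⟩ = |𝟐⟩`,
`|11⟩ = |𝟑⟩`. -/
def amplitude (ψ : State 4 4) (b : Fin 4 → Fin 2) : ℂ :=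
  ψ (finProdFinEquiv (b 0, b 1), finProdFinEquiv (b 2, b 3))

/-- The four-bit string that is `z` on the qubits in `T` and `x` on the others. -/
def joinBits (T : Finset (Fin 4)) (z : {q // q ∈ T} → Fin 2) (x : {q // q ∉ T} → Fin 2) :
    Fin 4 → Fin 2 :=
  fun q => if h : q ∈ T then z ⟨q, h⟩ else x ⟨q, h⟩

/-- The (unnormalized) reduced density matrix of `|ψ⟩⟨ψ|` after the qubits in `T` are
discarded (traced out). -/
def reduced (T : Finset (Fin 4)) (ψ : State 4 4) :
    Matrix ({q // q ∉ T} → Fin 2) ({q // q ∉ T} → Fin 2) ℂ :=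
  fun x y => ∑ z : {q // q ∈ T} → Fin 2,
    amplitude ψ (joinBits T z x) * star (amplitude ψ (joinBits T z y))

/-- There is a nonempty set of the four qubits that can be discarded such that the reduced states
are still mutually orthogonal. -/
def HasLocalRedundancy {ι : Type} (ψ : ι → State 4 4) : Prop :=
  ∃ T : Finset (Fin 4), T.Nonempty ∧
    Pairwise fun i j => (reduced T (ψ i) * reduced T (ψ j)).trace = 0

/-- The projector `P_{ij} = |i⟩⟨i| + |j⟩⟨j|` (for `i ≠ j`). -/
def proj {d : ℕ} (i j : Fin d) : Matrix (Fin d) (Fin d) ℂ :=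
  Matrix.single i i 1 + Matrix.single j j 1

/-- Alice's projectors `P_{03}`, `P_{12}`. -/
def projA : Fin 2 → Matrix (Fin 4) (Fin 4) ℂ := ![proj 0 3, proj 1 2]

/-- Bob's projectors `P_{01}`, `P_{23}`. -/
def projB : Fin 2 → Matrix (Fin 4) (Fin 4) ℂ := ![proj 0 1, proj 2 3]

theorem projA_complete : ∑ k, (projA k)ᴴ * projA k = 1 := by
  ext i j
  fin_cases i <;> fin_cases j <;>
    simp [projA, proj, Fin.sum_univ_two, Matrix.mul_apply, Matrix.single_apply]

/-- Alice's measurement `{P_{03}, P_{12}}`. -/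
def measA : LocalMeasurement 4 := ⟨2, fun _ => 4, projA, projA_complete⟩

theorem projB_complete : ∑ k, (projB k)ᴴ * projB k = 1 := by
  ext i j
  fin_cases i <;> fin_cases j <;>
    simp [projB, proj, Fin.sum_univ_two, Matrix.mul_apply, Matrix.single_apply]

/-- Bob's measurement `{P_{01}, P_{23}}`. -/
def measB : LocalMeasurement 4 := ⟨2, fun _ => 4, projB, projB_complete⟩

/-- The three states of the `ℂ^2 ⊗ ℂ^4` example. -/
def phi : Fin 3 → State 2 4 :=
  ![ket 0 0 + ket 0 2 + ket 1 1 - ket 1 3,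
    ket 0 0 - ket 0 2 - ket 1 1 - ket 1 3,
    ket 0 1 - ket 1 2 - ket 1 0 - ket 0 3]

/-- The six states of the `ℂ^4 ⊗ ℂ^4` example. -/
def psi : Fin 6 → State 4 4 :=
  ![ket 0 0 + ket 0 2 + ket 3 1 - ket 3 3,
    ket 0 0 - ket 0 2 - ket 3 1 - ket 3 3,
    ket 0 1 - ket 3 2 - ket 3 0 - ket 0 3,
    ket 1 0 + ket 1 2 + ket 2 1 - ket 2 3,
    ket 1 0 - ket 1 2 - ket 2 1 - ket 2 3,
    ket 1 1 - ket 2 2 - ket 2 0 - ket 1 3]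

/-- The position in the list of six of the `t`-th member of the `s`-th triple: the first triple
is `0, 1, 2`, the second is `3, 4, 5`. -/
def member (s : Fin 2) (t : Fin 3) : Fin 6 := finProdFinEquiv (s, t)

/-- The (unnormalized) state into which the `k`-th state is converted by outcome `μ` of Bob's
measurement `{P_{01}, P_{23}}`. -/
def post (μ : Fin 2) (k : Fin 6) : State 4 4 := localOp 1 (measB.op μ) (psi k)

/-- The six states that are left, up to a phase, after each of Bob's two outcomes. -/
def converted : Fin 2 → Fin 6 → State 4 4 :=
  ![![ket 0 0 + ket 3 1, ket 0 0 - ket 3 1, ket 0 1 - ket 3 0,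
      ket 1 0 + ket 2 1, ket 1 0 - ket 2 1, ket 1 1 - ket 2 0],
    ![ket 0 2 - ket 3 3, ket 0 2 + ket 3 3, ket 3 2 + ket 0 3,
      ket 1 2 - ket 2 3, ket 1 2 + ket 2 3, ket 2 2 + ket 1 3]]

end LocalActivation

end

open LocalActivation

/-! Everything reduces to two small families: `psi` is two copies of `phi` on orthogonal subspaces
of Alice's space (`localOp_isoA_phi`), and Bob's outcome `μ` turns each copy into three Bell states
`bell μ`, up to sign (`localOp_bell`). Nonvanishing, orthogonality and the protocols are transported
along these isometries.

Indistinguishability is tested on the fourth Bell state, `missingBell μ`. A rank-one 2×2 matrix has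
determinant zero, which in Bell coordinates says that a signed sum of four squared amplitudes
vanishes. So a product effect that excludes two members of the triple responds equally strongly to
the third and to the missing state (`bell_extension`). Each branch of an LOCC protocol is a product
operator, so an errorless protocol gives each answer on the missing state at least the weight it has
on the member it identifies (`LOCC.weight_le_weight`). Summing, the missing state would carry three
times its own squared norm.

Local redundancy fails because, for each qubit, some operator on that qubit alone connects two of
the states. -/

namespace LocalActivation

open Matrix

/-! ### Product operators, norms and completeness of measurements -/

section LocalOperators

variable {m n m' n' m'' n'' : ℕ}

theorem localOp_apply (K : Matrix (Fin m') (Fin m) ℂ) (L : Matrix (Fin n') (Fin n) ℂ)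
    (ψ : State m n) (p : Fin m' × Fin n') :
    localOp K L ψ p = ∑ i, ∑ j, K p.1 i * L p.2 j * ψ (i, j) := by
  simp [localOp, mulVec, dotProduct, kroneckerMap_apply, Fintype.sum_prod_type]

theorem localOp_localOp (K' : Matrix (Fin m'') (Fin m') ℂ) (L' : Matrix (Fin n'') (Fin n') ℂ)
    (K : Matrix (Fin m') (Fin m) ℂ) (L : Matrix (Fin n') (Fin n) ℂ) (ψ : State m n) :
    localOp K' L' (localOp K L ψ) = localOp (K' * K) (L' * L) ψ := by
  simp [localOp, mulVec_mulVec, mul_kronecker_mul]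

@[simp]
theorem localOp_one_one (ψ : State m n) : localOp 1 1 ψ = ψ := by
  simp [localOp]

@[simp]
theorem localOp_zero (K : Matrix (Fin m') (Fin m) ℂ) (L : Matrix (Fin n') (Fin n) ℂ) :
    localOp K L (0 : State m n) = 0 := by
  simp [localOp]

@[simp]
theorem localOp_zero_left (L : Matrix (Fin n') (Fin n) ℂ) (ψ : State m n) :
    localOp (0 : Matrix (Fin m') (Fin m) ℂ) L ψ = 0 := by
  simp [localOp]

theorem norm_sq_eq_re_dotProduct (ψ : State m n) :
    ‖ψ‖ ^ 2 = (star ψ.ofLp ⬝ᵥ ψ.ofLp).re := by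
  rw [EuclideanSpace.norm_sq_eq, dotProduct, Complex.re_sum]
  refine Finset.sum_congr rfl fun p _ => ?_
  rw [Pi.star_apply, Complex.star_def, ← Complex.normSq_eq_conj_mul_self, Complex.ofReal_re,
    Complex.normSq_eq_norm_sq]

theorem norm_sq_localOp (K : Matrix (Fin m') (Fin m) ℂ) (L : Matrix (Fin n') (Fin n) ℂ)
    (ψ : State m n) :
    ‖localOp K L ψ‖ ^ 2 = (star ψ.ofLp ⬝ᵥ (((Kᴴ * K) ⊗ₖ (Lᴴ * L)) *ᵥ ψ.ofLp)).re := by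
  rw [norm_sq_eq_re_dotProduct, localOp, star_mulVec, ← dotProduct_mulVec, mulVec_mulVec,
    conjTranspose_kronecker, mul_kronecker_mul]

theorem norm_sq_localOp_isometry {V : Matrix (Fin m') (Fin m) ℂ} {W : Matrix (Fin n') (Fin n) ℂ}
    (hV : Vᴴ * V = 1) (hW : Wᴴ * W = 1) (ψ : State m n) : ‖localOp V W ψ‖ ^ 2 = ‖ψ‖ ^ 2 := by
  rw [norm_sq_localOp, hV, hW, norm_sq_eq_re_dotProduct, one_kronecker_one, one_mulVec]

theorem LocalMeasurement.sum_norm_sq_left (M : LocalMeasurement m) (ψ : State m n) :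
    ∑ k, ‖localOp (M.op k) (1 : Matrix (Fin n) (Fin n) ℂ) ψ‖ ^ 2 = ‖ψ‖ ^ 2 := by
  simp_rw [norm_sq_localOp]
  rw [← Complex.re_sum, ← dotProduct_sum, ← sum_mulVec]
  have h : ∑ k, ((M.op k)ᴴ * M.op k) ⊗ₖ ((1 : Matrix (Fin n) (Fin n) ℂ)ᴴ * 1) = 1 := by
    have h := congrArg (fun A => A ⊗ₖ (1 : Matrix (Fin n) (Fin n) ℂ)) M.complete
    simp only [one_kronecker_one] at h
    rw [← h]
    ext p q
    simp [Matrix.sum_apply, Finset.sum_mul]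
  rw [h, one_mulVec, norm_sq_eq_re_dotProduct]

theorem LocalMeasurement.sum_norm_sq_right (M : LocalMeasurement n) (ψ : State m n) :
    ∑ k, ‖localOp (1 : Matrix (Fin m) (Fin m) ℂ) (M.op k) ψ‖ ^ 2 = ‖ψ‖ ^ 2 := by
  simp_rw [norm_sq_localOp]
  rw [← Complex.re_sum, ← dotProduct_sum, ← sum_mulVec]
  have h : ∑ k, ((1 : Matrix (Fin m) (Fin m) ℂ)ᴴ * 1) ⊗ₖ ((M.op k)ᴴ * M.op k) = 1 := by
    have h := congrArg (fun A => (1 : Matrix (Fin m) (Fin m) ℂ) ⊗ₖ A) M.complete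
    simp only [one_kronecker_one] at h
    rw [← h]
    ext p q
    simp [Matrix.sum_apply, Finset.mul_sum]
  rw [h, one_mulVec, norm_sq_eq_re_dotProduct]

end LocalOperators

/-! ### Outcome weights of LOCC protocols -/

namespace LOCC

variable {ι κ : Type} [DecidableEq ι] [DecidableEq κ]

theorem weight_nonneg {m n : ℕ} (P : LOCC ι m n) (ψ : State m n) (j : ι) :
    0 ≤ P.weight ψ j := by
  induction P with
  | answer i => rw [weight]; split_ifs <;> positivity
  | alice M next ih => exact Finset.sum_nonneg fun k _ => ih k _
  | bob M next ih => exact Finset.sum_nonneg fun k _ => ih k _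

@[simp]
theorem weight_zero {m n : ℕ} (P : LOCC ι m n) (j : ι) : P.weight 0 j = 0 := by
  induction P with
  | answer i => simp [weight]
  | alice M next ih => simp [weight, ih]
  | bob M next ih => simp [weight, ih]

theorem weight_alice_eq {m n : ℕ} {M : LocalMeasurement m}
    (next : (k : Fin M.outcomes) → LOCC ι (M.dim k) n) {ψ : State m n} (j : ι)
    (k : Fin M.outcomes) {χ : State (M.dim k) n} (hk : localOp (M.op k) 1 ψ = χ)
    (h : ∀ k', k' ≠ k → localOp (M.op k') (1 : Matrix (Fin n) (Fin n) ℂ) ψ = 0) :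
    (LOCC.alice M next).weight ψ j = (next k).weight χ j := by
  rw [weight, Finset.sum_eq_single k, hk]
  · intro k' _ hk'
    rw [h k' hk', weight_zero]
  · simp

theorem sum_weight [Fintype ι] {m n : ℕ} (P : LOCC ι m n) (ψ : State m n) :
    ∑ j, P.weight ψ j = ‖ψ‖ ^ 2 := by
  induction P with
  | answer i => simp [weight]
  | alice M next ih =>
    simp only [weight]
    rw [Finset.sum_comm, ← M.sum_norm_sq_left]
    exact Finset.sum_congr rfl fun k _ => ih k _
  | bob M next ih =>
    simp only [weight]
    rw [Finset.sum_comm, ← M.sum_norm_sq_right]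
    exact Finset.sum_congr rfl fun k _ => ih k _

/-- The weights are nonnegative and sum to the squared norm, so full weight on the right answer
leaves none for the others. -/
theorem distinguishes_iff [Fintype ι] {m n : ℕ} (P : LOCC ι m n) (ψ : ι → State m n) :
    P.Distinguishes ψ ↔ ∀ i j, i ≠ j → P.weight (ψ i) j = 0 := by
  refine forall_congr' fun i => ?_
  rw [← P.sum_weight (ψ i), ← Finset.add_sum_erase _ _ (Finset.mem_univ i), left_eq_add,
    Finset.sum_eq_zero_iff_of_nonneg fun j _ => P.weight_nonneg _ j]
  simp [eq_comm]

/-- The protocol `P` with its answers relabelled by `f`. -/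
def map (f : ι → κ) : {m n : ℕ} → LOCC ι m n → LOCC κ m n
  | _, _, .answer i => .answer (f i)
  | _, _, .alice M next => .alice M fun k => (next k).map f
  | _, _, .bob M next => .bob M fun k => (next k).map f

theorem weight_map {f : ι → κ} (hf : Function.Injective f) {m n : ℕ} (P : LOCC ι m n)
    (ψ : State m n) (j : ι) : (P.map f).weight ψ (f j) = P.weight ψ j := by
  induction P with
  | answer i => simp [weight, map, hf.eq_iff]
  | alice M next ih => simp [weight, map, ih]
  | bob M next ih => simp [weight, map, ih]

/-- If product effects that rule out all but one of the states `χ t` respond to `ω` at least as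
strongly as to the remaining one, then so does a protocol that never errs on the `χ t`. -/
theorem weight_le_weight {τ : Type} {a b : ℕ} {e : τ → ι} (he : Function.Injective e)
    {χ : τ → State a b} {ω : State a b}
    (h : ∀ (k : Fin a → ℂ) (l : Fin b → ℂ) (t : τ),
      (∀ t', t' ≠ t → ∑ i, ∑ j, k i * l j * χ t' (i, j) = 0) →
        ‖∑ i, ∑ j, k i * l j * χ t (i, j)‖ ≤ ‖∑ i, ∑ j, k i * l j * ω (i, j)‖)
    {m n : ℕ} (P : LOCC ι m n) (K : Matrix (Fin m) (Fin a) ℂ) (L : Matrix (Fin n) (Fin b) ℂ)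
    (hP : ∀ t j, e t ≠ j → P.weight (localOp K L (χ t)) j = 0) (t : τ) :
    P.weight (localOp K L (χ t)) (e t) ≤ P.weight (localOp K L ω) (e t) := by
  -- `K` and `L` accumulate the Kraus operators along a branch, so the claim passes to each
  -- subprotocol.
  induction P with
  | answer i =>
    simp only [weight] at hP ⊢
    split_ifs with hi
    · rw [EuclideanSpace.norm_sq_eq, EuclideanSpace.norm_sq_eq]
      refine Finset.sum_le_sum fun p _ => ?_
      rw [localOp_apply, localOp_apply]
      gcongr
      -- Each row of `K ⊗ L` is a product effect; at a leaf answering `e t`, absence of error forces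
      -- it to annihilate every other `χ t'`.
      refine h _ _ t fun t' ht' => ?_
      have h0 := hP t' i (hi ▸ he.ne ht')
      rw [if_pos rfl, sq_eq_zero_iff, norm_eq_zero] at h0
      rw [← localOp_apply K L (χ t') p, h0, PiLp.zero_apply]
    · exact le_rfl
  | alice M next ih =>
    simp only [weight, localOp_localOp] at hP ⊢
    refine Finset.sum_le_sum fun k _ => ih k _ _ fun t j hj => ?_
    exact (Finset.sum_eq_zero_iff_of_nonneg fun k _ => weight_nonneg _ _ _).1 (hP t j hj) k
      (Finset.mem_univ k)
  | bob M next ih =>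
    simp only [weight, localOp_localOp] at hP ⊢
    refine Finset.sum_le_sum fun k _ => ih k _ _ fun t j hj => ?_
    exact (Finset.sum_eq_zero_iff_of_nonneg fun k _ => weight_nonneg _ _ _).1 (hP t j hj) k
      (Finset.mem_univ k)

end LOCC

/-- By conservation of total weight, `ω` cannot supply the full weight of every `χ t`. The injection
`e` and the isometries let one test state serve the bare triple, its embedded copies and any larger
family containing one. -/
theorem not_locallyDistinguishable_of_extension {ι τ : Type} [DecidableEq ι] [Fintype ι]
    [Fintype τ] {a b m n : ℕ} {e : τ → ι} (he : Function.Injective e)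
    {χ : τ → State a b} {ω : State a b}
    (h : ∀ (k : Fin a → ℂ) (l : Fin b → ℂ) (t : τ),
      (∀ t', t' ≠ t → ∑ i, ∑ j, k i * l j * χ t' (i, j) = 0) →
        ‖∑ i, ∑ j, k i * l j * χ t (i, j)‖ ≤ ‖∑ i, ∑ j, k i * l j * ω (i, j)‖)
    (hω : ‖ω‖ ^ 2 < ∑ t, ‖χ t‖ ^ 2)
    {V : Matrix (Fin m) (Fin a) ℂ} {W : Matrix (Fin n) (Fin b) ℂ}
    (hV : Vᴴ * V = 1) (hW : Wᴴ * W = 1) {ψ : ι → State m n}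
    (hψ : ∀ t, localOp V W (χ t) = ψ (e t)) : ¬ LocallyDistinguishable ψ := by
  rintro ⟨P, hP⟩
  refine hω.not_ge ?_
  calc ∑ t, ‖χ t‖ ^ 2 = ∑ t, P.weight (localOp V W (χ t)) (e t) := by
        refine Finset.sum_congr rfl fun t _ => ?_
        rw [hψ, hP, ← hψ, norm_sq_localOp_isometry hV hW]
    _ ≤ ∑ t, P.weight (localOp V W ω) (e t) := by
        refine Finset.sum_le_sum fun t _ => P.weight_le_weight he h V W (fun t j hj => ?_) t
        rw [hψ]
        exact (P.distinguishes_iff ψ).1 hP _ _ hj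
    _ ≤ ∑ j, P.weight (localOp V W ω) j := by
        rw [← Finset.sum_image (f := P.weight (localOp V W ω)) (s := Finset.univ)
          (g := e) he.injOn]
        exact Finset.sum_le_sum_of_subset_of_nonneg (Finset.subset_univ _)
          fun j _ _ => P.weight_nonneg _ j
    _ = ‖ω‖ ^ 2 := by rw [P.sum_weight, norm_sq_localOp_isometry hV hW]

/-! ### Reduction of the six states to `phi` and to Bell states -/

theorem ket_apply {m n : ℕ} (i i' : Fin m) (j j' : Fin n) :
    (ket i j : State m n) (i', j') = if i' = i ∧ j' = j then 1 else 0 := by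
  simp [ket, Prod.ext_iff]

section Linear

variable {m n m' n' : ℕ} (K : Matrix (Fin m') (Fin m) ℂ) (L : Matrix (Fin n') (Fin n) ℂ)
  (ψ ψ' : State m n)

theorem localOp_add : localOp K L (ψ + ψ') = localOp K L ψ + localOp K L ψ' := by
  simp [localOp, mulVec_add]

theorem localOp_sub : localOp K L (ψ - ψ') = localOp K L ψ - localOp K L ψ' := by
  simp [localOp, mulVec_sub]

theorem localOp_neg : localOp K L (-ψ) = -localOp K L ψ := by
  simp [localOp, mulVec_neg]

theorem localOp_ket_apply (i : Fin m) (j : Fin n) (p : Fin m' × Fin n') :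
    localOp K L (ket i j) p = K p.1 i * L p.2 j := by
  simp [localOp_apply, ket_apply, ite_and]

end Linear

/-- The operator `∑ i, |f i⟩⟨i|`. -/
def embed {m n : ℕ} (f : Fin m → Fin n) : Matrix (Fin n) (Fin m) ℂ :=
  of fun x i => if x = f i then 1 else 0

theorem embed_id {m : ℕ} : embed (id : Fin m → Fin m) = 1 := by
  ext i j
  simp [embed, one_apply]

theorem localOp_embed_ket {m n m' n' : ℕ} (f : Fin m → Fin m') (g : Fin n → Fin n')
    (i : Fin m) (j : Fin n) : localOp (embed f) (embed g) (ket i j) = ket (f i) (g j) := by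
  ext ⟨x, y⟩
  simp only [localOp_ket_apply, ket_apply, embed, of_apply, ite_and, mul_ite, mul_one, mul_zero]
  split_ifs <;> rfl

theorem embed_conjTranspose_mul {m m' n : ℕ} (f : Fin m → Fin n) (g : Fin m' → Fin n) :
    (embed f)ᴴ * embed g = of fun i j => if f i = g j then 1 else 0 := by
  ext i j
  simp [embed, mul_apply, eq_comm]

/-- The isometry onto the range of `projA s`. -/
def isoA (s : Fin 2) : Matrix (Fin 4) (Fin 2) ℂ := embed (![![0, 3], ![1, 2]] s)

/-- The isometry onto the range of `projB μ`. -/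
def isoB (μ : Fin 2) : Matrix (Fin 4) (Fin 2) ℂ := embed (![![0, 1], ![2, 3]] μ)

theorem isoA_conjTranspose_mul (s s' : Fin 2) : (isoA s)ᴴ * isoA s' = if s = s' then 1 else 0 := by
  rw [isoA, isoA, embed_conjTranspose_mul]
  fin_cases s <;> fin_cases s' <;> ext i j <;> fin_cases i <;> fin_cases j <;> simp

theorem isoA_isometry (s : Fin 2) : (isoA s)ᴴ * isoA s = 1 := by
  simp [isoA_conjTranspose_mul]

theorem isoA_mul_conjTranspose (s : Fin 2) : isoA s * (isoA s)ᴴ = projA s := by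
  fin_cases s <;> ext i j <;> fin_cases i <;> fin_cases j <;>
    simp [isoA, embed, projA, proj, mul_apply]

theorem isoB_isometry (μ : Fin 2) : (isoB μ)ᴴ * isoB μ = 1 := by
  rw [isoB, embed_conjTranspose_mul]
  fin_cases μ <;> ext i j <;> fin_cases i <;> fin_cases j <;> simp

theorem isoB_mul_conjTranspose (μ : Fin 2) : isoB μ * (isoB μ)ᴴ = projB μ := by
  fin_cases μ <;> ext i j <;> fin_cases i <;> fin_cases j <;>
    simp [isoB, embed, projB, proj, mul_apply]

theorem forall_member {p : Fin 6 → Prop} : (∀ k, p k) ↔ ∀ s t, p (member s t) := by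
  rw [← (finProdFinEquiv (m := 2) (n := 3)).forall_congr_right, Prod.forall]
  rfl

theorem member_injective (s : Fin 2) : Function.Injective (member s) := fun t t' h => by
  simpa [member] using h

theorem localOp_isoA_phi (s : Fin 2) (t : Fin 3) :
    localOp (isoA s) 1 (phi t) = psi (member s t) := by
  rw [← embed_id]
  fin_cases s <;> fin_cases t <;>
    simp [isoA, phi, psi, member, finProdFinEquiv, localOp_add, localOp_sub, localOp_embed_ket]

theorem psi_member (s : Fin 2) (t : Fin 3) : psi (member s t) = localOp (isoA s) 1 (phi t) :=
  (localOp_isoA_phi s t).symm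

/-- The two-qubit form of the states `post μ (member s t)`. -/
noncomputable def bell : Fin 2 → Fin 3 → State 2 2 :=
  -- The signs in the second row are those produced by projecting `phi`, so that the comparison with
  -- `post` is an equality without phases.
  ![![ket 0 0 + ket 1 1, ket 0 0 - ket 1 1, ket 0 1 - ket 1 0],
    ![ket 0 0 - ket 1 1, -ket 0 0 - ket 1 1, -ket 1 0 - ket 0 1]]

/-- The Bell state that is missing from `bell μ`. -/
noncomputable def missingBell : Fin 2 → State 2 2 :=
  ![ket 0 1 + ket 1 0, ket 0 1 - ket 1 0]

theorem localOp_projB_ket {m : ℕ} (μ : Fin 2) (i : Fin m) (j : Fin 4) :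
    localOp 1 (projB μ) (ket i j) = if j ∈ Set.range (![![0, 1], ![2, 3]] μ) then ket i j else 0 := by
  ext ⟨x, y⟩
  fin_cases μ <;> fin_cases j <;> fin_cases y <;>
    simp [localOp_ket_apply, ket_apply, projB, proj, one_apply]

theorem localOp_isoB_bell (μ : Fin 2) (t : Fin 3) :
    localOp (1 : Matrix (Fin 2) (Fin 2) ℂ) (isoB μ) (bell μ t) = localOp 1 (projB μ) (phi t) := by
  have h (i : Fin 2) (j : Fin 2) : localOp (1 : Matrix (Fin 2) (Fin 2) ℂ) (isoB μ) (ket i j)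
      = ket i (![![0, 1], ![2, 3]] μ j) := by
    rw [← embed_id, isoB, localOp_embed_ket, id]
  fin_cases μ <;> fin_cases t <;>
    simp_all [phi, bell, localOp_add, localOp_sub, localOp_neg, localOp_projB_ket]

theorem localOp_bell (μ : Fin 2) (s : Fin 2) (t : Fin 3) :
    localOp (isoA s) (isoB μ) (bell μ t) = post μ (member s t) := by
  have h := congrArg (localOp (isoA s) (1 : Matrix (Fin 4) (Fin 4) ℂ)) (localOp_isoB_bell μ t)
  rw [localOp_localOp, localOp_localOp, Matrix.mul_one, Matrix.one_mul, Matrix.one_mul] at h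
  change _ = localOp 1 (projB μ) _
  rw [h, psi_member, localOp_localOp, Matrix.mul_one, Matrix.one_mul]

/-! ### Local indistinguishability of three Bell states -/

/-- With `a± = k₀l₀ ± k₁l₁` and `b± = k₀l₁ ± k₁l₀`, the identity `a₊² - a₋² = b₊² - b₋²` holds, both
sides being `4k₀k₁l₀l₁`. When two of the four vanish, the other two have equal squares up to sign.
-/
theorem bell_extension (μ : Fin 2) (k l : Fin 2 → ℂ) (t : Fin 3)
    (h : ∀ t', t' ≠ t → ∑ i, ∑ j, k i * l j * bell μ t' (i, j) = 0) :
    ‖∑ i, ∑ j, k i * l j * bell μ t (i, j)‖ ≤ ‖∑ i, ∑ j, k i * l j * missingBell μ (i, j)‖ := by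
  have norm_eq {x y : ℂ} (hxy : x ^ 2 = y ^ 2 ∨ x ^ 2 = -y ^ 2) : ‖x‖ = ‖y‖ := by
    rw [← sq_eq_sq₀ (norm_nonneg _) (norm_nonneg _), ← norm_pow, ← norm_pow]
    rcases hxy with hxy | hxy <;> simp [hxy]
  refine (norm_eq ?_).le
  have h0 := h 0
  have h1 := h 1
  have h2 := h 2
  clear h norm_eq
  fin_cases μ <;> fin_cases t <;>
    simp [Fin.sum_univ_two, bell, missingBell, ket_apply] at h0 h1 h2 ⊢ <;>
    first
    | (left; grind)
    | (right; grind)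

theorem norm_missingBell_lt (μ : Fin 2) : ‖missingBell μ‖ ^ 2 < ∑ t, ‖bell μ t‖ ^ 2 := by
  fin_cases μ <;>
    simp [EuclideanSpace.norm_sq_eq, Fintype.sum_prod_type, Fin.sum_univ_two, Fin.sum_univ_three,
      bell, missingBell, ket_apply]

theorem not_locallyDistinguishable_bell (μ : Fin 2) : ¬ LocallyDistinguishable (bell μ) :=
  not_locallyDistinguishable_of_extension Function.injective_id (bell_extension μ)
    (norm_missingBell_lt μ) (V := 1) (W := 1) (by simp) (by simp) fun t => by simp

theorem not_locallyDistinguishable_post_member (μ s : Fin 2) :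
    ¬ LocallyDistinguishable fun t => post μ (member s t) :=
  not_locallyDistinguishable_of_extension Function.injective_id (bell_extension μ)
    (norm_missingBell_lt μ) (isoA_isometry s) (isoB_isometry μ) (localOp_bell μ s)

theorem not_locallyDistinguishable_post (μ : Fin 2) : ¬ LocallyDistinguishable (post μ) :=
  not_locallyDistinguishable_of_extension (member_injective 0) (bell_extension μ)
    (norm_missingBell_lt μ) (isoA_isometry 0) (isoB_isometry μ) (localOp_bell μ 0)

theorem post_eq_smul_converted (μ : Fin 2) (k : Fin 6) :
    ∃ c : ℂ, ‖c‖ = 1 ∧ post μ k = c • converted μ k := by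
  revert k
  rw [forall_member]
  intro s t
  -- Only the last two members of each triple under `P_{23}` differ in sign from the listed states.
  refine ⟨![![1, 1, 1], ![1, -1, -1]] μ t, ?_, ?_⟩
  · fin_cases μ <;> fin_cases t <;> simp
  · rw [← localOp_bell]
    fin_cases μ <;> fin_cases s <;> fin_cases t <;>
      simp [bell, isoA, isoB, localOp_add, localOp_sub, localOp_neg, localOp_embed_ket, converted,
        member, finProdFinEquiv] <;> abel

/-! ### Orthogonality and nonvanishing -/

/-- The scalar `c` covers both uses: `c = 1` within a triple and `c = 0` between the triples, whose
ranges on Alice's side are orthogonal. -/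
theorem inner_localOp_isometry {m n m' n' : ℕ} {V : Matrix (Fin m') (Fin m) ℂ}
    {V' : Matrix (Fin m') (Fin m) ℂ} {W : Matrix (Fin n') (Fin n) ℂ} {c : ℂ}
    (hV : Vᴴ * V' = c • 1) (hW : Wᴴ * W = 1) (ψ ψ' : State m n) :
    inner ℂ (localOp V W ψ) (localOp V' W ψ') = c * inner ℂ ψ ψ' := by
  rw [EuclideanSpace.inner_eq_star_dotProduct, EuclideanSpace.inner_eq_star_dotProduct,
    dotProduct_comm, dotProduct_comm ψ'.ofLp, localOp, localOp, star_mulVec, ← dotProduct_mulVec,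
    mulVec_mulVec, conjTranspose_kronecker, ← mul_kronecker_mul, hV, hW, smul_kronecker,
    one_kronecker_one, smul_mulVec, one_mulVec, dotProduct_smul, smul_eq_mul]

theorem orthogonal_of_member {n n' : ℕ} {W : Matrix (Fin n') (Fin n) ℂ} (hW : Wᴴ * W = 1)
    {χ : Fin 3 → State 2 n} (hχ : Orthogonal χ) {ψ : Fin 6 → State 4 n'}
    (h : ∀ s t, localOp (isoA s) W (χ t) = ψ (member s t)) : Orthogonal ψ := by
  simp only [Orthogonal, Pairwise]
  rw [forall_member]
  intro s t
  rw [forall_member]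
  intro s' t' hne
  rw [← h, ← h]
  by_cases hs : s = s'
  · subst hs
    rw [inner_localOp_isometry (c := 1) (by simp [isoA_conjTranspose_mul]) hW,
      hχ fun ht => hne (by rw [ht]), mul_zero]
  · rw [inner_localOp_isometry (c := 0) (by simp [isoA_conjTranspose_mul, hs]) hW, zero_mul]

theorem ne_zero_of_member {n n' : ℕ} {W : Matrix (Fin n') (Fin n) ℂ} (hW : Wᴴ * W = 1)
    {χ : Fin 3 → State 2 n} (hχ : ∀ t, χ t ≠ 0) {ψ : Fin 6 → State 4 n'}
    (h : ∀ s t, localOp (isoA s) W (χ t) = ψ (member s t)) (k : Fin 6) : ψ k ≠ 0 := by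
  revert k
  rw [forall_member]
  intro s t h0
  have hn := norm_sq_localOp_isometry (isoA_isometry s) hW (χ t)
  rw [h, h0] at hn
  refine hχ t ?_
  simpa using hn.symm

theorem orthogonal_bell (μ : Fin 2) : Orthogonal (bell μ) := by
  intro t t' ht
  fin_cases μ <;> fin_cases t <;> fin_cases t' <;>
    first
    | exact absurd rfl ht
    | (rw [PiLp.inner_apply]
       simp [Fintype.sum_prod_type, Fin.sum_univ_two, bell, ket_apply])

theorem orthogonal_phi : Orthogonal phi := by
  intro t t' ht
  fin_cases t <;> fin_cases t' <;>
    first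
    | exact absurd rfl ht
    | (rw [PiLp.inner_apply]
       simp [Fintype.sum_prod_type, Fin.sum_univ_four, phi,
        ket_apply])

theorem bell_ne_zero (μ : Fin 2) (t : Fin 3) : bell μ t ≠ 0 := by
  intro h
  have h0 := congrArg (fun ψ : State 2 2 => ψ (0, 0)) h
  have h1 := congrArg (fun ψ : State 2 2 => ψ (0, 1)) h
  fin_cases μ <;> fin_cases t <;> simp [bell, ket_apply] at h0 h1

theorem phi_ne_zero (t : Fin 3) : phi t ≠ 0 := by
  intro h
  have h0 := congrArg (fun ψ : State 2 4 => ψ (0, 0)) h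
  have h1 := congrArg (fun ψ : State 2 4 => ψ (0, 1)) h
  fin_cases t <;> simp [phi, ket_apply] at h0 h1

/-! ### Distinguishing protocols -/

/-- The measurement in the basis `|0⟩ ± |1⟩`. -/
noncomputable def hadamardMeas : LocalMeasurement 2 where
  outcomes := 2
  dim _ := 1
  op s := ((√2 : ℝ) : ℂ)⁻¹ • ![!![1, 1], !![1, -1]] s
  complete := by
    have h : ((√2 : ℝ) : ℂ)⁻¹ * ((√2 : ℝ) : ℂ)⁻¹ = 2⁻¹ := by
      rw [← mul_inv, ← Complex.ofReal_mul, Real.mul_self_sqrt (by norm_num)]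
      norm_num
    ext i j
    fin_cases i <;> fin_cases j <;>
      simp [Fin.sum_univ_two, mul_apply, Matrix.sum_apply, h] <;> norm_num

/-- Bob's orthogonal measurement after outcome `s` of `hadamardMeas`. -/
noncomputable def signMeas (s : Fin 2) : LocalMeasurement 4 where
  outcomes := 4
  dim _ := 1
  -- For each `s`, the first three rows are Bob's conditional states from `phi`, which remain
  -- orthogonal; the fourth completes the basis and never occurs, so its answer is arbitrary.
  op k := (2 : ℂ)⁻¹ • ![![!![1, 1, 1, -1], !![1, -1, -1, -1], !![-1, 1, -1, -1], !![1, 1, -1, 1]],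
    ![!![1, -1, 1, 1], !![1, 1, -1, 1], !![1, 1, 1, -1], !![-1, 1, 1, 1]]] s k
  complete := by
    fin_cases s <;> ext i j <;> fin_cases i <;> fin_cases j <;>
      simp [Fin.sum_univ_four, mul_apply, Matrix.sum_apply] <;> norm_num

/-- The one-way protocol that distinguishes the states `phi`. -/
noncomputable def phiProtocol : LOCC (Fin 3) 2 4 :=
  .alice hadamardMeas fun s => .bob (signMeas s) fun k => .answer (![0, 1, 2, 0] k)

theorem localOp_signMeas_phi (s : Fin 2) (k : Fin 4) (t : Fin 3) (h : k = 3 ∨ ![0, 1, 2, 0] k ≠ t) :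
    localOp (hadamardMeas.op s) ((signMeas s).op k) (phi t) = 0 := by
  ext ⟨x, y⟩
  change Fin 1 at x
  change Fin 1 at y
  fin_cases s <;> fin_cases k <;> fin_cases t <;>
    first
    | (exfalso; revert h; decide)
    | (simp [localOp_ket_apply, phi, localOp_add, localOp_sub, hadamardMeas, signMeas]
       ring_nf
       try rfl)

theorem phiProtocol_distinguishes : phiProtocol.Distinguishes phi := by
  rw [LOCC.distinguishes_iff]
  intro t t' ht
  simp only [phiProtocol, LOCC.weight, localOp_localOp]
  refine Finset.sum_eq_zero fun s _ => Finset.sum_eq_zero fun k _ => ?_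
  split_ifs with hk
  · rw [Matrix.mul_one, Matrix.one_mul, localOp_signMeas_phi s k t (Or.inr (hk ▸ ht.symm))]
    simp
  · rfl

/-- The measurement that separates the ranges of `isoA 0` and `isoA 1`, mapping each to a qubit. -/
noncomputable def isoMeas : LocalMeasurement 4 where
  outcomes := 2
  dim _ := 2
  op s := (isoA s)ᴴ
  complete := by
    simp_rw [conjTranspose_conjTranspose, isoA_mul_conjTranspose]
    rw [← projA_complete]
    refine Finset.sum_congr rfl fun s _ => ?_
    rw [← isoA_mul_conjTranspose, conjTranspose_mul, conjTranspose_conjTranspose,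
      Matrix.mul_assoc, ← Matrix.mul_assoc (isoA s)ᴴ, isoA_isometry, Matrix.one_mul]

theorem localOp_projA_psi (s s' : Fin 2) (t : Fin 3) :
    localOp (measA.op s) 1 (psi (member s' t)) = if s = s' then psi (member s' t) else 0 := by
  change localOp (projA s) 1 _ = _
  rw [psi_member, localOp_localOp, ← isoA_mul_conjTranspose, Matrix.mul_assoc,
    isoA_conjTranspose_mul]
  split_ifs with h
  · simp [h]
  · simp

theorem localOp_isoMeas_psi (s s' : Fin 2) (t : Fin 3) :
    localOp (isoMeas.op s) 1 (psi (member s' t)) = if s = s' then phi t else 0 := by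
  change localOp (isoA s)ᴴ 1 _ = _
  rw [psi_member, localOp_localOp, isoA_conjTranspose_mul]
  split_ifs with h <;> simp

/-- The protocol that follows Alice's measurement `{P_03, P_12}`. -/
noncomputable def psiNext (s : Fin measA.outcomes) : LOCC (Fin 6) (measA.dim s) 4 :=
  -- The second measurement only compresses the selected range to a qubit; its outcome on the states
  -- `psi` is already determined by `s`.
  .alice isoMeas fun _ => phiProtocol.map (member s)

theorem psiProtocol_distinguishes :
    (LOCC.alice measA psiNext).Distinguishes psi := by
  rw [LOCC.Distinguishes, forall_member]
  intro s t
  calc (LOCC.alice measA psiNext).weight (psi (member s t)) (member s t)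
      = (psiNext s).weight (psi (member s t)) (member s t) :=
        LOCC.weight_alice_eq (M := measA) psiNext _ s
          ((localOp_projA_psi s s t).trans (if_pos rfl))
          fun r hr => (localOp_projA_psi r s t).trans (if_neg hr)
    _ = (phiProtocol.map (member s)).weight (phi t) (member s t) :=
        LOCC.weight_alice_eq (M := isoMeas) _ _ s
          ((localOp_isoMeas_psi s s t).trans (if_pos rfl))
          fun r hr => (localOp_isoMeas_psi r s t).trans (if_neg hr)
    _ = ‖psi (member s t)‖ ^ 2 := by
        rw [LOCC.weight_map (member_injective s), phiProtocol_distinguishes, psi_member,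
          norm_sq_localOp_isometry (isoA_isometry s) (by simp)]

/-! ### Absence of local redundancy -/

/-- The matrix of amplitudes of `ψ`, with the qubits in `T` as columns. -/
def amplitudeMatrix (T : Finset (Fin 4)) (ψ : State 4 4) :
    Matrix ({q // q ∉ T} → Fin 2) ({q // q ∈ T} → Fin 2) ℂ :=
  of fun x z => amplitude ψ (joinBits T z x)

theorem reduced_eq (T : Finset (Fin 4)) (ψ : State 4 4) :
    reduced T ψ = amplitudeMatrix T ψ * (amplitudeMatrix T ψ)ᴴ := by
  ext x y
  simp [reduced, amplitudeMatrix, mul_apply]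

-- By cyclicity, the trace is the squared Frobenius norm of the product on the right.
open scoped ComplexOrder in
theorem trace_reduced_mul_reduced_eq_zero_iff (T : Finset (Fin 4)) (ψ χ : State 4 4) :
    (reduced T ψ * reduced T χ).trace = 0 ↔
      (amplitudeMatrix T χ)ᴴ * amplitudeMatrix T ψ = 0 := by
  rw [← trace_mul_conjTranspose_self_eq_zero_iff, conjTranspose_mul, conjTranspose_conjTranspose,
    reduced_eq, reduced_eq, Matrix.mul_assoc, trace_mul_comm, trace_mul_comm (_ * _) (_ * _)]
  simp only [Matrix.mul_assoc]

/-- If discarding a set of qubits that contains `q` leaves two states orthogonal, then the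
operator `∑ c, |d⟩⟨c|` on the qubit `q` does not connect them. -/
theorem sum_amplitude_update_eq_zero {T : Finset (Fin 4)} {q : Fin 4} (hq : q ∈ T)
    {ψ χ : State 4 4} (h : (reduced T ψ * reduced T χ).trace = 0) (d : Fin 2) :
    ∑ b : Fin 4 → Fin 2, star (amplitude χ (Function.update b q d)) * amplitude ψ b = 0 := by
  rw [trace_reduced_mul_reduced_eq_zero_iff] at h
  rw [← (Equiv.piEquivPiSubtypeProd (· ∈ T) fun _ => Fin 2).symm.sum_comp, Fintype.sum_prod_type]
  refine Finset.sum_eq_zero fun z _ => ?_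
  -- This entry pairs the discarded bits `z` of `ψ` with the same bits of `χ` after resetting `q` to
  -- `d`; the sum over `x` runs over the retained qubits.
  have hz := congrFun (congrFun h (Function.update z ⟨q, hq⟩ d)) z
  rw [mul_apply] at hz
  refine Eq.trans ?_ hz
  refine Finset.sum_congr rfl fun x _ => ?_
  have hu : Function.update (joinBits T z x) q d = joinBits T (Function.update z ⟨q, hq⟩ d) x := by
    ext p
    by_cases hp : p = q
    · subst hp
      simp [joinBits, hq]
    · simp [joinBits, hp]
  change star (amplitude χ (Function.update (joinBits T z x) q d)) * _ = _
  rw [hu]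
  rfl

theorem not_hasLocalRedundancy_psi : ¬ HasLocalRedundancy psi := by
  rintro ⟨T, ⟨q, hq⟩, h⟩
  have key (i j : Fin 6) (hij : i ≠ j) := sum_amplitude_update_eq_zero hq (h hij) 0
  have hsum (f : (Fin 4 → Fin 2) → ℂ) :
      ∑ b, f b = ∑ b₀, ∑ b₁, ∑ b₂, ∑ b₃, f ![b₀, b₁, b₂, b₃] := by
    simp only [← (Fin.consEquiv fun _ => Fin 2).sum_comp, Fintype.sum_prod_type]
    simp [Fin.consEquiv]
    rfl
  -- One pair for each qubit `q = 0, 1, 2, 3` in turn: resetting that qubit to `0` in the first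
  -- state gives a vector with overlap `2` with the second. This handles every `T` containing `q` at
  -- once.
  have h0 := key 0 5 (by decide)
  have h1 := key 0 3 (by decide)
  have h2 := key 0 1 (by decide)
  have h3 := key 2 1 (by decide)
  clear h key
  simp only [hsum, Fin.sum_univ_two] at h0 h1 h2 h3
  fin_cases q
  · clear h1 h2 h3
    simp [amplitude, psi, ket_apply, finProdFinEquiv] at h0
  · clear h0 h2 h3
    simp [amplitude, psi, ket_apply, finProdFinEquiv] at h1
  · clear h0 h1 h3
    simp [amplitude, psi, ket_apply, finProdFinEquiv] at h2
  · clear h0 h1 h2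
    simp [amplitude, psi, ket_apply, finProdFinEquiv] at h3

end LocalActivation

theorem mainTheorem3 :
    -- six pairwise orthogonal states without local redundancy
    (∀ k, psi k ≠ 0) ∧ Orthogonal psi ∧ ¬ HasLocalRedundancy psi ∧
    -- they are distinguished by a protocol that begins with Alice's measurement `{P_03, P_12}`
    LocallyDistinguishable psi ∧
    (∃ next : (s : Fin measA.outcomes) → LOCC (Fin 6) (measA.dim s) 4,
      (LOCC.alice measA next).Distinguishes psi) ∧
    -- which separates two triples and leaves each of them unchanged
    (∀ (s s' : Fin 2) (t : Fin 3),
      localOp (measA.op s) 1 (psi (member s' t)) = if s = s' then psi (member s' t) else 0) ∧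
    -- each triple being a copy of the distinguishable `ℂ^2 ⊗ ℂ^4` example
    LocallyDistinguishable phi ∧
    (∀ s : Fin 2, ∃ V : Matrix (Fin 4) (Fin 2) ℂ, Vᴴ * V = 1 ∧ V * Vᴴ = projA s ∧
      ∀ t : Fin 3, localOp V 1 (phi t) = psi (member s t)) ∧
    -- whatever the outcome `μ` of Bob's measurement `{P_01, P_23}` is
    (∀ μ : Fin 2,
      -- the six states are converted into six orthogonal states, namely those listed
      (∀ k, post μ k ≠ 0) ∧ Orthogonal (post μ) ∧
      (∀ k, ∃ c : ℂ, ‖c‖ = 1 ∧ post μ k = c • converted μ k) ∧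
      -- each of the two triples lies in a two-qubit subspace, and is locally indistinguishable
      -- there as well as in the whole space
      (∀ s : Fin 2,
        (∃ (V W : Matrix (Fin 4) (Fin 2) ℂ) (χ : Fin 3 → State 2 2),
          Vᴴ * V = 1 ∧ V * Vᴴ = projA s ∧ Wᴴ * W = 1 ∧ W * Wᴴ = projB μ ∧
          (∀ t, localOp V W (χ t) = post μ (member s t)) ∧
          ¬ LocallyDistinguishable χ) ∧
        ¬ LocallyDistinguishable (fun t => post μ (member s t))) ∧
      -- so the converted set is locally indistinguishable
      ¬ LocallyDistinguishable (post μ)) := by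
  refine ⟨ne_zero_of_member (by simp) phi_ne_zero localOp_isoA_phi,
    orthogonal_of_member (by simp) orthogonal_phi localOp_isoA_phi, not_hasLocalRedundancy_psi,
    ⟨_, psiProtocol_distinguishes⟩, ⟨_, psiProtocol_distinguishes⟩, localOp_projA_psi,
    ⟨_, phiProtocol_distinguishes⟩,
    fun s => ⟨isoA s, isoA_isometry s, isoA_mul_conjTranspose s, localOp_isoA_phi s⟩,
    fun μ => ⟨ne_zero_of_member (isoB_isometry μ) (bell_ne_zero μ) (localOp_bell μ),
      orthogonal_of_member (isoB_isometry μ) (orthogonal_bell μ) (localOp_bell μ),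
      post_eq_smul_converted μ, fun s => ⟨⟨isoA s, isoB μ, bell μ, isoA_isometry s,
        isoA_mul_conjTranspose s, isoB_isometry μ, isoB_mul_conjTranspose μ, localOp_bell μ s,
        not_locallyDistinguishable_bell μ⟩, not_locallyDistinguishable_post_member μ s⟩,
      not_locallyDistinguishable_post μ⟩⟩
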